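/- Let $d\ge 1$, $\varepsilon>0$, $G(x)=(1+|x|)^{-d-\varepsilon}$ for $x\in\mathbb R^d$, and let $\Gamma_G$ be the set of locally finite $\gamma\subset\mathbb R^d$ with $\sum_{x\in\gamma}G(x)<\infty$, with the topology in which $\gamma_n\to\gamma$ iff $\sum_{x\in\gamma_n}f(x)\to\sum_{x\in\gamma}f(x)$ for all bounded continuous $f$ with $|f|\le M_fG$ for some $M_f>0$, and with its Borel $\sigma$-algebra. Let $m>0$ and let $b:\mathbb R^d\times\Gamma_G\to[0,\infty)$ be measurable, with $\sup_{x,\gamma}b(x,\gamma)<\infty$ and, for some $M>0$, $$\sup_{\gamma\in\Gamma_G}|b(x,\gamma\cup\{y\})-b(x,\gamma)|\le M\,G(x-y),\qquad x,y\in\mathbb R^d .$$ Let $(\gamma_t)_{t\ge0}$ be a spatial birth-and-death process with constant death rate $m$ and birth rate $b$ on a probability space with a right-continuous complete filtration $(\mathcal F_t)_{t\ge0}$. That is: $(\gamma_t)$ is adapted, with càdlàg paths in $\Gamma_G$; $N$ is a Poisson point process on $\mathbb R_+\times\mathbb R^d\times\mathbb R_+^2$ with mean measure $ds\times dx\times du\times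 e^{-r}dr$, compatible with the filtration (for every measurable $A\subset\mathbb R^d\times\mathbb R_+^2$, $N([0,t]\times A)$ is $\mathcal F_t$-measurable for all $t\ge0$, and $N((t,s]\times A)$ is independent of $\mathcal F_t$ for $0<t<s$); $\gamma_0$ is $\mathcal F_0$-measurable and independent of $N$; $\tilde\gamma_0\subset\mathbb R^d\times\mathbb R_+$ is obtained by attaching to the points of $\gamma_0$, enumerated measurably as a function of $\gamma_0$, independent unit exponential variables that are independent of $(\gamma_0,N)$; and for every $t\ge0$ and every bounded Borel $\Lambda\subset\mathbb R^d$, almost surely, $$|\gamma_t\cap\Lambda|=\int_{(0,t]\times\Lambda\times\mathbb R_+^2}\mathbf 1_{[0,b(x,\gamma_{s-})]}(u)\,\mathbf 1_{(m(t-s),\infty)}(r)\,N(ds,dx,du,dr)+\int_{\Lambda\times\mathbb R_+}\mathbf 1_{(mt,\infty)}(r)\,\tilde\gamma_0(dx,dr).$$ Then, almost surely, for every $T\ge 0$ and every bounded $\Lambda\subset\mathbb R^d$, the map $[0,T]\ni t\mapsto\gamma_t\cap\Lambda$ changes its value only finitely many times; that is, there is a finite set $F\subset[0,\infty)$ such that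 $\gamma_s\cap\Lambda=\gamma_t\cap\Lambda$ whenever $0\le s\le t\le T$ and $F\cap(s,t]=\emptyset$. -/

import Mathlib

open MeasureTheory ProbabilityTheory Set Filter Topology
open scoped NNReal ENNReal

/-- The location space `ℝ^d` with its Euclidean norm. -/
abbrev Pt (d : ℕ) : Type := EuclideanSpace ℝ (Fin d)

/-- The weight `G(x) = (1 + |x|)^(-d-ε)`. -/
noncomputable def weight {d : ℕ} (ε : ℝ) (x : Pt d) : ℝ :=
  (1 + ‖x‖) ^ (-(d : ℝ) - ε)

/-- A configuration is a locally finite set. -/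
def IsConfiguration {E : Type*} [Bornology E] (γ : Set E) : Prop :=
  ∀ B : Set E, Bornology.IsBounded B → (γ ∩ B).Finite

/-- The space `Γ_G` of tempered configurations: locally finite sets `γ ⊆ ℝ^d` such that
`∑_{x ∈ γ} G(x) < ∞`. -/
structure TemperedConfig (d : ℕ) (ε : ℝ) where
  carrier : Set (Pt d)
  locallyFinite : IsConfiguration carrier
  tempered : Summable fun x : carrier => weight ε (x : Pt d)

namespace TemperedConfig

/-- The pairing `⟨f, γ⟩ = ∑_{x ∈ γ} f(x)`. -/
noncomputable def pairing {d : ℕ} {ε : ℝ} (f : Pt d → ℝ) (γ : TemperedConfig d ε) : ℝ :=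
  ∑' x : γ.carrier, f (x : Pt d)

/-- The bounded continuous functions `f` with `|f| ≤ M G` for some `M > 0`. -/
structure IsTest {d : ℕ} (ε : ℝ) (f : Pt d → ℝ) : Prop where
  continuous : Continuous f
  bounded : ∃ C : ℝ, ∀ x, |f x| ≤ C
  dominated : ∃ M : ℝ, 0 < M ∧ ∀ x, |f x| ≤ M * weight ε x

/-- The topology of `Γ_G`: `γ_n → γ` iff `⟨f, γ_n⟩ → ⟨f, γ⟩` for every test function `f`.
(It is the weak topology of the finite measures `G(x) γ(dx)`, hence metrizable and determined by
its convergent sequences.) -/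
noncomputable instance {d : ℕ} {ε : ℝ} : TopologicalSpace (TemperedConfig d ε) :=
  ⨅ f : {f : Pt d → ℝ // IsTest ε f}, TopologicalSpace.induced (pairing f.1) inferInstance

/-- The Borel σ-algebra of `Γ_G`. -/
noncomputable instance {d : ℕ} {ε : ℝ} : MeasurableSpace (TemperedConfig d ε) :=
  borel (TemperedConfig d ε)

instance {d : ℕ} {ε : ℝ} : BorelSpace (TemperedConfig d ε) := ⟨rfl⟩

/-- The configuration `γ ∪ {y}`. -/
def addPoint {d : ℕ} {ε : ℝ} (γ : TemperedConfig d ε) (y : Pt d) : TemperedConfig d ε where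
  carrier := γ.carrier ∪ {y}
  locallyFinite := by
    intro B hB
    rw [Set.union_inter_distrib_right]
    exact (γ.locallyFinite B hB).union ((Set.finite_singleton y).inter_of_left B)
  tempered := by
    by_cases hy : y ∈ γ.carrier
    · have h : γ.carrier ∪ {y} = γ.carrier := by simpa using hy
      rw [h]
      exact γ.tempered
    · have hd : Disjoint γ.carrier {y} := by simpa using hy
      have h2 : Summable ((weight ε : Pt d → ℝ) ∘ (Subtype.val : ({y} : Set (Pt d)) → Pt d)) :=
        (Set.finite_singleton y).summable _
      have h1 : Summable ((weight ε : Pt d → ℝ) ∘ (Subtype.val : γ.carrier → Pt d)) := γ.tempered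
      exact (HasSum.add_disjoint (f := (weight ε : Pt d → ℝ)) hd h1.hasSum h2.hasSum).summable

end TemperedConfig

/-! ### Point processes -/

/-- The number `N(A)` of points of the random set `N` in the window `A`. -/
noncomputable def windowCount {Ω E : Type*} (N : Ω → Set E) (A : Set E) (ω : Ω) : ℕ∞ :=
  (N ω ∩ A).encard

/-- The σ-algebra on `Ω` generated by a random set, through its counting variables. -/
noncomputable abbrev pointSigma {Ω E : Type*} [MeasurableSpace E] (N : Ω → Set E) : MeasurableSpace Ω :=
  ⨆ A : {A : Set E // MeasurableSet A}, MeasurableSpace.comap (windowCount N A.1) inferInstance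

/-- `N` is a Poisson point process on `E` with mean measure `μ`, realised as a random
configuration. -/
structure IsPoissonPointProcess {Ω E : Type*} [MeasurableSpace Ω] [MeasurableSpace E] [Bornology E]
    (P : Measure Ω) (μ : Measure E) (N : Ω → Set E) : Prop where
  configuration : ∀ ω, IsConfiguration (N ω)
  measurable : ∀ A : Set E, MeasurableSet A → Measurable (windowCount N A)
  law : ∀ A : Set E, MeasurableSet A → μ A ≠ ⊤ →
    P.map (windowCount N A) = (poissonMeasure (μ A).toNNReal).map (fun n : ℕ => (n : ℕ∞))
  indep : ∀ (n : ℕ) (A : Fin n → Set E), (∀ i, MeasurableSet (A i)) →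
    Pairwise (fun i j => Disjoint (A i) (A j)) → iIndepFun (fun i => windowCount N (A i)) P

/-- Lebesgue measure on `ℝ_+ = [0, ∞)`. -/
noncomputable def halfLebesgue : Measure ℝ≥0 :=
  (volume : Measure ℝ).comap (fun s : ℝ≥0 => (s : ℝ))

/-- The unit exponential law `e^{-r} dr` on `ℝ_+`. -/
noncomputable def unitExp : Measure ℝ≥0 :=
  halfLebesgue.withDensity fun r => ENNReal.ofReal (Real.exp (-(r : ℝ)))

/-- The space `ℝ_+ × ℝ^d × ℝ_+^2` of points `(s, x, u, r)`. -/
abbrev DrivingSpace (d : ℕ) : Type := ℝ≥0 × Pt d × ℝ≥0 × ℝ≥0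

/-- The mean measure `ds × dx × du × e^{-r} dr`. -/
noncomputable def drivingMeasure (d : ℕ) : Measure (DrivingSpace d) :=
  halfLebesgue.prod ((volume : Measure (Pt d)).prod (halfLebesgue.prod unitExp))

/-- Compatibility of `N` with a filtration: `N([0,t], A)` is `ℱ_t`-measurable and `N((t,s], A)` is
independent of `ℱ_t` for `0 < t < s`. -/
structure IsCompatible {Ω : Type*} {mΩ : MeasurableSpace Ω} {d : ℕ} (P : Measure Ω)
    (𝓕 : Filtration ℝ≥0 mΩ) (N : Ω → Set (DrivingSpace d)) : Prop where
  measurable : ∀ (A : Set (Pt d × ℝ≥0 × ℝ≥0)) (t : ℝ≥0), MeasurableSet A →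
    Measurable[𝓕 t] (windowCount N (Icc 0 t ×ˢ A))
  indep : ∀ (A : Set (Pt d × ℝ≥0 × ℝ≥0)) (t s : ℝ≥0), MeasurableSet A → 0 < t → t < s →
    Indep (MeasurableSpace.comap (windowCount N (Ioc t s ×ˢ A)) inferInstance) (𝓕 t) P

/-- The filtration is right-continuous and complete. -/
structure IsUsual {Ω : Type*} {mΩ : MeasurableSpace Ω} (P : Measure Ω)
    (𝓕 : Filtration ℝ≥0 mΩ) : Prop where
  rightContinuous : ∀ t : ℝ≥0, (⨅ s : {s : ℝ≥0 // t < s}, 𝓕 s.1) = 𝓕 t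
  complete : ∀ A : Set Ω, P A = 0 → MeasurableSet[𝓕 0] A

/-! ### The birth-and-death process -/

/-- A measurable enumeration without repetition of the points of each configuration `γ`:
`γ = {e i γ : i < |γ|}`. -/
structure IsEnumeration {d : ℕ} {ε : ℝ} (e : ℕ → TemperedConfig d ε → Pt d) : Prop where
  measurable : ∀ i, Measurable (e i)
  image : ∀ γ : TemperedConfig d ε,
    (fun i => e i γ) '' {i : ℕ | (i : ℕ∞) < γ.carrier.encard} = γ.carrier
  injOn : ∀ γ : TemperedConfig d ε,
    InjOn (fun i => e i γ) {i : ℕ | (i : ℕ∞) < γ.carrier.encard}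

/-- The marked initial configuration `{(x_i, τ_i)}`, where `x_i` runs through the points of `γ`. -/
def markedConfig {d : ℕ} {ε : ℝ} (e : ℕ → TemperedConfig d ε → Pt d) (γ : TemperedConfig d ε)
    (τ : ℕ → ℝ≥0) : Set (Pt d × ℝ≥0) :=
  {p | ∃ i : ℕ, (i : ℕ∞) < γ.carrier.encard ∧ p = (e i γ, τ i)}

/-- Right-continuity with left limits. -/
def IsCadlagPath {E : Type*} [TopologicalSpace E] (f : ℝ≥0 → E) : Prop :=
  ∀ t : ℝ≥0, ContinuousWithinAt f (Ici t) t ∧ ∃ l : E, Tendsto f (𝓝[<] t) (𝓝 l)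

/-- `γ` is a birth-and-death process with constant death rate `m` and birth rate `b`, i.e. a
solution of the equation driven by the Poisson process `N` and by the unit exponential
lifetimes `τ` of the points of the initial configuration `γ 0` (enumerated by `e`). -/
structure IsBirthDeathProcess {d : ℕ} {ε : ℝ} {Ω : Type*} {mΩ : MeasurableSpace Ω}
    (P : Measure Ω) (𝓕 : Filtration ℝ≥0 mΩ) (m : ℝ) (b : Pt d → TemperedConfig d ε → ℝ≥0)
    (N : Ω → Set (DrivingSpace d)) (e : ℕ → TemperedConfig d ε → Pt d) (τ : ℕ → Ω → ℝ≥0)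
    (γ : ℝ≥0 → Ω → TemperedConfig d ε) : Prop where
  usual : IsUsual P 𝓕
  poisson : IsPoissonPointProcess P (drivingMeasure d) N
  compatible : IsCompatible P 𝓕 N
  /-- In particular `γ 0` is `ℱ_0`-measurable. -/
  adapted : ∀ t, Measurable[𝓕 t] (γ t)
  cadlag : ∀ ω, IsCadlagPath fun t => γ t ω
  initial_indep : Indep (MeasurableSpace.comap (γ 0) inferInstance) (pointSigma N) P
  enumeration : IsEnumeration e
  mark_measurable : ∀ i, Measurable (τ i)
  mark_law : ∀ i, P.map (τ i) = unitExp
  mark_iIndep : iIndepFun τ P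
  mark_indep : Indep (⨆ i, MeasurableSpace.comap (τ i) inferInstance)
    (MeasurableSpace.comap (γ 0) inferInstance ⊔ pointSigma N) P
  /-- The number of points of `γ_t` in `Λ` is the number of points `(s, x, u, r)` of `N` with
  `0 < s ≤ t`, `x ∈ Λ`, `u ≤ b(x, γ_{s-})`, `r > m (t - s)`, plus the number of initial marked
  points `(x, r)` with `x ∈ Λ`, `r > m t`. -/
  equation : ∀ (t : ℝ≥0) (Λ : Set (Pt d)), MeasurableSet Λ → Bornology.IsBounded Λ → ∀ᵐ ω ∂P,
    ((γ t ω).carrier ∩ Λ).encard =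
      {p : DrivingSpace d | p ∈ N ω ∧ 0 < p.1 ∧ p.1 ≤ t ∧ p.2.1 ∈ Λ ∧
        p.2.2.1 ≤ b p.2.1 (Function.leftLim (fun s => γ s ω) p.1) ∧
        m * ((t : ℝ) - (p.1 : ℝ)) < (p.2.2.2 : ℝ)}.encard +
      {q : Pt d × ℝ≥0 | q ∈ markedConfig e (γ 0 ω) (fun i => τ i ω) ∧ q.1 ∈ Λ ∧
        m * (t : ℝ) < (q.2 : ℝ)}.encard

/-- `f` changes its value only finitely many times on `[0, T]`: there is a finite set `F` of
change times such that `f s = f t` whenever `s ≤ t ≤ T` and no change time lies in `(s, t]`. -/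
def ChangesFinitelyOften {E : Type*} (f : ℝ≥0 → E) (T : ℝ≥0) : Prop :=
  ∃ F : Finset ℝ≥0, ∀ s t : ℝ≥0, s ≤ t → t ≤ T → (∀ c ∈ F, c ∉ Ioc s t) → f s = f t

/-!
Fix a ball `Λ` and a horizon `K`. Since `b ≤ C`, the equation for `γ_t` involves, inside `Λ` and up
to time `K`, only the atoms of `N` in `[0, K] × Λ × [0, C] × ℝ_+` and the initial points in `Λ`. The
mean measure of this window is finite because the lifetimes have a finite law, so almost surely
there are finitely many such atoms (`IsPoissonPointProcess.ae_finite_inter`); the initial points in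
`Λ` are finitely many because `γ_0` is locally finite (`finite_markedConfig`). Each atom `(s, x, u, r)`
contributes to `γ_t` exactly for `s ≤ t < s + r / m`, and each initial point `(x, r)` exactly for
`t < r / m`. Hence, if none of these finitely many birth and death times lies in `(s, t]`, the right
hand sides of the equations at `s` and at `t` agree (`livingAtoms_eq`, `livingInitial_eq`).

The equation holds almost surely only for a fixed time and a fixed set, so it is used for a countable
dense set of times and for the bounded members of a countable basis of `ℝ^d`. Equal numbers of points
in all small basic sets force equal configurations in `Λ` (`inter_subset_of_encard_basis_eq`), which
settles times in the dense set. Right-continuity of the path, tested against tent functions that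
isolate a single point (`TemperedConfig.inter_eq_of_frequently`), passes to all times
(`TemperedConfig.inter_eq_of_dense`).
-/

namespace TemperedConfig

variable {d : ℕ} {ε : ℝ}

/-! ### Tent functions and the topology of the configuration space -/

/-- The tent function of height one and radius `r` centred at `x`. -/
noncomputable def tent (x : Pt d) (r : ℝ) (y : Pt d) : ℝ := max 0 (1 - dist y x / r)

lemma tent_eq_zero {x y : Pt d} {r : ℝ} (hr : 0 < r) (h : r ≤ dist y x) : tent x r y = 0 := by
  have : 1 ≤ dist y x / r := (one_le_div hr).2 h
  exact max_eq_left (by linarith)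

lemma tent_self (x : Pt d) (r : ℝ) : tent x r x = 1 := by simp [tent]

lemma abs_tent_le_one (x : Pt d) {r : ℝ} (hr : 0 < r) (y : Pt d) : |tent x r y| ≤ 1 := by
  have h : 0 ≤ dist y x / r := by positivity
  rw [tent, abs_of_nonneg (le_max_left _ _)]
  exact max_le zero_le_one (by linarith)

lemma isTest_tent (hε : 0 < ε) (x : Pt d) {r : ℝ} (hr : 0 < r) : IsTest ε (tent x r) where
  continuous := by unfold tent; fun_prop
  bounded := ⟨1, abs_tent_le_one x hr⟩
  dominated := by
    -- On the support of the tent, `1 + |y| ≤ R`, so that the weight is at least `w`.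
    set R : ℝ := 1 + ‖x‖ + r with hR
    have hRpos : 0 < R := by positivity
    set w : ℝ := R ^ (-(d : ℝ) - ε) with hw
    have hwpos : 0 < w := Real.rpow_pos_of_pos hRpos _
    refine ⟨w⁻¹, inv_pos.2 hwpos, fun y => ?_⟩
    have hG : 0 ≤ weight ε y := Real.rpow_nonneg (by positivity) _
    by_cases hy : r ≤ dist y x
    · rw [tent_eq_zero hr hy, abs_zero]
      positivity
    · have hyn : 1 + ‖y‖ ≤ R := by
        have h1 : ‖y‖ ≤ ‖x‖ + dist y x := by
          rw [dist_eq_norm]; simpa using norm_add_le x (y - x)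
        linarith [not_le.1 hy]
      have hle : w ≤ weight ε y :=
        Real.rpow_le_rpow_of_nonpos (by positivity) hyn
          (by have : (0 : ℝ) ≤ d := Nat.cast_nonneg d
              linarith)
      refine (abs_tent_le_one x hr y).trans ?_
      rw [inv_mul_eq_div]
      exact (one_le_div hwpos).2 hle

lemma continuous_pairing {f : Pt d → ℝ} (hf : IsTest ε f) :
    Continuous (pairing f : TemperedConfig d ε → ℝ) :=
  continuous_iInf_dom (i := ⟨f, hf⟩) continuous_induced_dom

open Classical in
/-- A tent that meets the configuration at most in its centre detects whether the centre is a
point of the configuration. -/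
lemma pairing_tent {γ : TemperedConfig d ε} {x : Pt d} {r : ℝ} (hr : 0 < r)
    (h : γ.carrier ∩ Metric.ball x r ⊆ {x}) :
    pairing (tent x r) γ = if x ∈ γ.carrier then 1 else 0 := by
  have hzero : ∀ y : γ.carrier, (y : Pt d) ≠ x → tent x r y = 0 := fun y hy =>
    tent_eq_zero hr (not_lt.1 fun hlt => hy (h ⟨y.2, Metric.mem_ball.2 hlt⟩))
  unfold pairing
  split_ifs with hx
  · rw [tsum_eq_single (⟨x, hx⟩ : γ.carrier)
      (fun y hy => hzero y fun h' => hy (Subtype.ext h')), tent_self]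
  · rw [← tsum_zero (α := ℝ) (β := γ.carrier)]
    exact tsum_congr fun y => hzero y fun h' => hx (h' ▸ y.2)

/-- If configurations converging to `l` frequently have the trace `A` on a bounded open set, then
so does `l`. -/
lemma inter_eq_of_frequently (hε : 0 < ε) {ι : Type*} {F : Filter ι} {g : ι → TemperedConfig d ε}
    {l : TemperedConfig d ε} (hg : Tendsto g F (𝓝 l)) {Λ A : Set (Pt d)} (hΛ : IsOpen Λ)
    (hΛb : Bornology.IsBounded Λ) (hA : ∃ᶠ i in F, (g i).carrier ∩ Λ = A) :
    l.carrier ∩ Λ = A := by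
  classical
  obtain ⟨i₀, hi₀⟩ := hA.exists
  have hfin : (l.carrier ∩ Λ ∪ A).Finite :=
    (l.locallyFinite Λ hΛb).union (hi₀ ▸ (g i₀).locallyFinite Λ hΛb)
  have hAΛ : A ⊆ Λ := hi₀ ▸ inter_subset_right
  have key : ∀ x ∈ Λ, (x ∈ l.carrier ↔ x ∈ A) := by
    intro x hx
    have hopen : IsOpen (Λ \ ((l.carrier ∩ Λ ∪ A) \ {x})) :=
      hΛ.sdiff (hfin.subset sdiff_subset).isClosed
    obtain ⟨r, hr, hball⟩ := Metric.isOpen_iff.1 hopen x ⟨hx, fun h => h.2 rfl⟩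
    have hsub : ∀ γ : TemperedConfig d ε, γ.carrier ∩ Λ ⊆ l.carrier ∩ Λ ∪ A →
        γ.carrier ∩ Metric.ball x r ⊆ {x} := fun γ hγ y hy => by
      by_contra hne
      exact (hball hy.2).2 ⟨hγ ⟨hy.1, (hball hy.2).1⟩, hne⟩
    have hlim := ((continuous_pairing (isTest_tent hε x hr)).tendsto l).comp hg
    rw [pairing_tent hr (hsub l subset_union_left)] at hlim
    -- The pairings frequently take the value `1_A(x)`, so this is their limit.
    have hval : ∃ᶠ i in F, (pairing (tent x r) ∘ g) i ∈ ({if x ∈ A then 1 else 0} : Set ℝ) := by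
      refine hA.mono fun i hi => ?_
      have hmem : x ∈ (g i).carrier ↔ x ∈ A :=
        ⟨fun h => hi ▸ ⟨h, hx⟩, fun h => (hi.symm ▸ h : x ∈ (g i).carrier ∩ Λ).1⟩
      rw [Function.comp_apply, pairing_tent hr (hsub (g i) (hi ▸ subset_union_right)),
        mem_singleton_iff]
      simp only [hmem]
    have hmem := isClosed_singleton.mem_of_frequently_of_tendsto hval hlim
    rw [mem_singleton_iff] at hmem
    split_ifs at hmem <;> simp_all
  ext x
  exact ⟨fun h => (key x h.2).1 h.1, fun h => ⟨(key x (hAΛ h)).2 h, hAΛ h⟩⟩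

/-- For a right-continuous path, constancy of the trace on a bounded open set away from the finite
set `F` needs to be checked on a dense set of times only. -/
lemma inter_eq_of_dense (hε : 0 < ε) {g : ℝ≥0 → TemperedConfig d ε} (hg : IsCadlagPath g)
    {D : Set ℝ≥0} (hD : Dense D) {Λ : Set (Pt d)} (hΛ : IsOpen Λ)
    (hΛb : Bornology.IsBounded Λ) {F : Finset ℝ≥0} {K : ℝ≥0}
    (h : ∀ s ∈ D, ∀ t ∈ D, s ≤ t → t ≤ K → (∀ c ∈ F, c ∉ Ioc s t) →
      (g s).carrier ∩ Λ = (g t).carrier ∩ Λ)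
    {s t : ℝ≥0} (hst : s ≤ t) (htK : t < K) (hF : ∀ c ∈ F, c ∉ Ioc s t) :
    (g s).carrier ∩ Λ = (g t).carrier ∩ Λ := by
  have right : ∀ v u : ℝ≥0, u ∈ D → v < u → u ≤ K → (∀ c ∈ F, c ∉ Ioc v u) →
      (g v).carrier ∩ Λ = (g u).carrier ∩ Λ := by
    intro v u hu hvu huK hc
    have hlim : Tendsto g (𝓝[>] v) (𝓝 (g v)) :=
      ((hg v).1).mono_left (nhdsWithin_mono v Ioi_subset_Ici_self)
    refine inter_eq_of_frequently hε hlim hΛ hΛb ?_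
    rw [(nhdsGT_basis_of_exists_gt ⟨u, hvu⟩).frequently_iff]
    intro w hw
    obtain ⟨q, hq, hvq, hqw⟩ := hD.exists_between (lt_min hw hvu)
    refine ⟨q, ⟨hvq, hqw.trans_le (min_le_left _ _)⟩, ?_⟩
    exact h q hq u hu (hqw.le.trans (min_le_right _ _)) huK
      fun c hcF hcI => hc c hcF ⟨hvq.trans hcI.1, hcI.2⟩
  -- A time `u ∈ D` after `t` such that `F` does not meet `(t, u]`.
  obtain ⟨w, htw, hw⟩ : ∃ w, t < w ∧ ∀ c ∈ F, c ∉ Ioo t w := by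
    have hev : ∀ᶠ w in 𝓝[>] t, ∀ c ∈ F, c ∉ Ioo t w := by
      rw [Filter.eventually_all_finset]
      intro c _
      by_cases hct : t < c
      · filter_upwards [Ioo_mem_nhdsGT hct] with w hw hcw
        exact lt_asymm hw.2 hcw.2
      · exact Eventually.of_forall fun w hcw => hct hcw.1
    obtain ⟨w, hw, htw⟩ := (hev.and self_mem_nhdsWithin).exists
    exact ⟨w, htw, hw⟩
  obtain ⟨u, hu, htu, huw⟩ := hD.exists_between (lt_min htw htK)
  have huK : u ≤ K := huw.le.trans (min_le_right _ _)
  have hFu : ∀ c ∈ F, c ∉ Ioc t u := fun c hc hcI =>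
    hw c hc ⟨hcI.1, hcI.2.trans_lt (huw.trans_le (min_le_left _ _))⟩
  rw [right t u hu htu huK hFu]
  refine right s u hu (hst.trans_lt htu) huK fun c hc hcI => ?_
  rcases le_or_gt c t with hct | hct
  · exact hF c hc ⟨hcI.1, hct⟩
  · exact hFu c hc ⟨hct, hcI.2⟩

end TemperedConfig

/-! ### Configurations and their counts -/

/-- The trace of a configuration on an open set is determined by the counts in small basic sets:
a point outside a locally finite set has a neighbourhood that misses the set. -/
lemma inter_subset_of_encard_basis_eq {d : ℕ} {B : Set (Set (Pt d))}
    (hB : TopologicalSpace.IsTopologicalBasis B) {γ₁ γ₂ Λ : Set (Pt d)}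
    (hγ₂ : IsConfiguration γ₂) (hΛ : IsOpen Λ) (hΛb : Bornology.IsBounded Λ)
    (h : ∀ U ∈ B, U ⊆ Λ → (γ₁ ∩ U).encard = (γ₂ ∩ U).encard) :
    γ₁ ∩ Λ ⊆ γ₂ ∩ Λ := by
  rintro x ⟨hx, hxΛ⟩
  refine ⟨by_contra fun hx₂ => ?_, hxΛ⟩
  obtain ⟨U, hU, hxU, hsub⟩ := hB.exists_subset_of_mem_open
    (show x ∈ Λ \ (γ₂ ∩ Λ) from ⟨hxΛ, fun h' => hx₂ h'.1⟩)
    (hΛ.sdiff (hγ₂ Λ hΛb).isClosed)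
  have hempty : γ₂ ∩ U = ∅ :=
    eq_empty_of_forall_notMem fun y hy => (hsub hy.2).2 ⟨hy.1, (hsub hy.2).1⟩
  have h0 := h U hU fun y hy => (hsub hy).1
  rw [hempty, encard_empty, encard_eq_zero] at h0
  exact notMem_empty x (h0 ▸ ⟨hx, hxU⟩)

lemma finite_markedConfig {d : ℕ} {ε : ℝ} {e : ℕ → TemperedConfig d ε → Pt d}
    (he : IsEnumeration e) (γ : TemperedConfig d ε) (τ : ℕ → ℝ≥0) {Λ : Set (Pt d)}
    (hΛ : Bornology.IsBounded Λ) :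
    {q : Pt d × ℝ≥0 | q ∈ markedConfig e γ τ ∧ q.1 ∈ Λ}.Finite := by
  refine Set.Finite.of_finite_image ((γ.locallyFinite Λ hΛ).subset ?_) (f := Prod.fst) ?_
  · rintro _ ⟨_, ⟨⟨i, hi, rfl⟩, hx⟩, rfl⟩
    exact ⟨he.image γ ▸ mem_image_of_mem _ hi, hx⟩
  · rintro _ ⟨⟨i, hi, rfl⟩, -⟩ _ ⟨⟨j, hj, rfl⟩, -⟩ hij
    rw [he.injOn γ hi hj hij]

/-! ### The driving Poisson process -/

lemma IsPoissonPointProcess.ae_finite_inter {Ω E : Type*} [MeasurableSpace Ω] [MeasurableSpace E]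
    [Bornology E] {P : Measure Ω} {μ : Measure E} {N : Ω → Set E}
    (hN : IsPoissonPointProcess P μ N) {A : Set E} (hA : MeasurableSet A) (hμ : μ A ≠ ⊤) :
    ∀ᵐ ω ∂P, (N ω ∩ A).Finite := by
  have h : P.map (windowCount N A) {⊤} = 0 := by
    rw [hN.law A hA hμ, Measure.map_apply measurable_from_top (measurableSet_singleton _)]
    have : (fun n : ℕ => (n : ℕ∞)) ⁻¹' {⊤} = ∅ := by ext n; simp
    rw [this, measure_empty]
  rw [Measure.map_apply (hN.measurable A hA) (measurableSet_singleton _)] at h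
  rw [ae_iff]
  refine measure_mono_null (fun ω hω => ?_) h
  exact encard_eq_top_iff.2 hω

instance : IsFiniteMeasureOnCompacts halfLebesgue :=
  IsFiniteMeasureOnCompacts.comap' volume NNReal.continuous_coe
    NNReal.isClosedEmbedding_coe.measurableEmbedding

instance : SigmaFinite halfLebesgue :=
  have := isLocallyFiniteMeasure_of_isFiniteMeasureOnCompacts (μ := halfLebesgue)
  inferInstance

instance : SFinite unitExp := by unfold unitExp; infer_instance

lemma drivingMeasure_window_lt_top {d : ℕ} (hexp : unitExp univ < ⊤) (K C : ℝ≥0)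
    {Λ : Set (Pt d)} (hΛ : Bornology.IsBounded Λ) :
    drivingMeasure d (Icc 0 K ×ˢ (Λ ×ˢ (Icc 0 C ×ˢ univ))) < ⊤ := by
  rw [drivingMeasure, Measure.prod_prod, Measure.prod_prod, Measure.prod_prod]
  exact ENNReal.mul_lt_top isCompact_Icc.measure_lt_top <|
    ENNReal.mul_lt_top hΛ.measure_lt_top <|
      ENNReal.mul_lt_top isCompact_Icc.measure_lt_top hexp

/-! ### Birth and death times -/

lemma le_iff_le_of_notMem_Ioc {α : Type*} [LinearOrder α] {s t c : α} (hst : s ≤ t)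
    (hc : c ∉ Ioc s t) : c ≤ s ↔ c ≤ t :=
  ⟨fun h => h.trans hst, fun h => not_lt.1 fun h' => hc ⟨h', h⟩⟩

/-- The set of birth and death times of a finite set `Q` of atoms of the driving process and of a
finite set `R` of marked initial points. -/
noncomputable def eventTimes {d : ℕ} (m : ℝ≥0) (Q : Finset (DrivingSpace d))
    (R : Finset (Pt d × ℝ≥0)) : Finset ℝ≥0 :=
  Q.image (fun p => p.1) ∪ Q.image (fun p => p.1 + p.2.2.2 / m) ∪ R.image (fun q => q.2 / m)

/-- A point born at time `a` with mark `r` is alive at time `t` exactly before its death time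
`a + r / m`. -/
lemma lt_lifetime_iff {m : ℝ} (hm : 0 < m) (t a r : ℝ≥0) :
    m * ((t : ℝ) - a) < r ↔ ¬ a + r / m.toNNReal ≤ t := by
  rw [not_le, ← NNReal.coe_lt_coe, NNReal.coe_add, NNReal.coe_div, Real.coe_toNNReal m hm.le,
    ← sub_lt_iff_lt_add', lt_div_iff₀ hm, mul_comm]

/-- If none of the event times of `Q ⊇ N ∩ ([0, K] × Λ × [0, C] × ℝ_+)` lies in `(s, t]`, then an
atom of `N` contributes to the population of `U ⊆ Λ` at both of the times `s`, `t` or at neither.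
Only the bound `C` on the birth rates `β p` matters, not how they depend on the past. -/
lemma livingAtoms_eq {d : ℕ} {m : ℝ} (hm : 0 < m) {C K s t : ℝ≥0} (hst : s ≤ t) (htK : t ≤ K)
    {Λ U : Set (Pt d)} (hU : U ⊆ Λ) {A : Set (DrivingSpace d)} {β : DrivingSpace d → ℝ≥0}
    (hβ : ∀ p, β p ≤ C) {Q : Finset (DrivingSpace d)} {R : Finset (Pt d × ℝ≥0)}
    (hQ : A ∩ (Icc 0 K ×ˢ (Λ ×ˢ (Icc 0 C ×ˢ univ))) ⊆ Q)
    (hF : ∀ c ∈ eventTimes m.toNNReal Q R, c ∉ Ioc s t) :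
    {p : DrivingSpace d | p ∈ A ∧ 0 < p.1 ∧ p.1 ≤ s ∧ p.2.1 ∈ U ∧ p.2.2.1 ≤ β p ∧
      m * ((s : ℝ) - (p.1 : ℝ)) < (p.2.2.2 : ℝ)} =
    {p : DrivingSpace d | p ∈ A ∧ 0 < p.1 ∧ p.1 ≤ t ∧ p.2.1 ∈ U ∧ p.2.2.1 ≤ β p ∧
      m * ((t : ℝ) - (p.1 : ℝ)) < (p.2.2.2 : ℝ)} := by
  have hmem : ∀ p ∈ A, p.1 ≤ t → p.2.1 ∈ U → p.2.2.1 ≤ β p → p ∈ Q := fun p hp hpt hpU hpβ =>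
    hQ ⟨hp, ⟨zero_le, hpt.trans htK⟩, hU hpU, ⟨zero_le, hpβ.trans (hβ p)⟩, mem_univ _⟩
  have hbirth : ∀ p ∈ Q, (p.1 ≤ s ↔ p.1 ≤ t) := fun p hp => le_iff_le_of_notMem_Ioc hst <|
    hF _ (Finset.mem_union_left _ (Finset.mem_union_left _ (Finset.mem_image_of_mem _ hp)))
  have hdeath : ∀ p ∈ Q, (m * ((s : ℝ) - (p.1 : ℝ)) < (p.2.2.2 : ℝ) ↔
      m * ((t : ℝ) - (p.1 : ℝ)) < (p.2.2.2 : ℝ)) := fun p hp => by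
    rw [lt_lifetime_iff hm, lt_lifetime_iff hm]
    exact not_congr <| le_iff_le_of_notMem_Ioc hst <|
      hF _ (Finset.mem_union_left _ (Finset.mem_union_right _
        (Finset.mem_image_of_mem (fun p : DrivingSpace d => p.1 + p.2.2.2 / m.toNNReal) hp)))
  ext p
  constructor
  · rintro ⟨hA, h0, h1, h2, h3, h4⟩
    have hp := hmem p hA (h1.trans hst) h2 h3
    exact ⟨hA, h0, (hbirth p hp).1 h1, h2, h3, (hdeath p hp).1 h4⟩
  · rintro ⟨hA, h0, h1, h2, h3, h4⟩
    have hp := hmem p hA h1 h2 h3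
    exact ⟨hA, h0, (hbirth p hp).2 h1, h2, h3, (hdeath p hp).2 h4⟩

/-- The analogue of `livingAtoms_eq` for the marked initial points in `U ⊆ Λ`. -/
lemma livingInitial_eq {d : ℕ} {m : ℝ} (hm : 0 < m) {s t : ℝ≥0} (hst : s ≤ t)
    {Λ U : Set (Pt d)} (hU : U ⊆ Λ) {I : Set (Pt d × ℝ≥0)} {Q : Finset (DrivingSpace d)}
    {R : Finset (Pt d × ℝ≥0)} (hR : {q | q ∈ I ∧ q.1 ∈ Λ} ⊆ (R : Set (Pt d × ℝ≥0)))
    (hF : ∀ c ∈ eventTimes m.toNNReal Q R, c ∉ Ioc s t) :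
    {q : Pt d × ℝ≥0 | q ∈ I ∧ q.1 ∈ U ∧ m * (s : ℝ) < (q.2 : ℝ)} =
    {q : Pt d × ℝ≥0 | q ∈ I ∧ q.1 ∈ U ∧ m * (t : ℝ) < (q.2 : ℝ)} := by
  ext q
  refine and_congr_right fun hI => and_congr_right fun hqU => ?_
  have hs := lt_lifetime_iff hm s 0 q.2
  have ht := lt_lifetime_iff hm t 0 q.2
  rw [NNReal.coe_zero, sub_zero, zero_add] at hs ht
  rw [hs, ht]
  exact not_congr <| le_iff_le_of_notMem_Ioc hst <|
    hF _ (Finset.mem_union_right _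
      (Finset.mem_image_of_mem (fun q : Pt d × ℝ≥0 => q.2 / m.toNNReal) (hR ⟨hI, hU hqU⟩)))

/-! ### Finitely many changes -/

theorem mainTheorem3 (d : ℕ) (hd : 1 ≤ d) (ε : ℝ) (hε : 0 < ε) (m : ℝ) (hm : 0 < m)
    (b : Pt d → TemperedConfig d ε → ℝ≥0) (hb : Measurable (Function.uncurry b))
    (hb_bdd : ∃ C : ℝ≥0, ∀ (x : Pt d) (γ : TemperedConfig d ε), b x γ ≤ C)
    (hb_lip : ∃ M : ℝ, 0 < M ∧ ∀ (x y : Pt d) (γ : TemperedConfig d ε),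
      |(b x (γ.addPoint y) : ℝ) - (b x γ : ℝ)| ≤ M * weight ε (x - y))
    {Ω : Type*} {mΩ : MeasurableSpace Ω} (P : Measure Ω) [IsProbabilityMeasure P]
    (𝓕 : Filtration ℝ≥0 mΩ) (N : Ω → Set (DrivingSpace d))
    (e : ℕ → TemperedConfig d ε → Pt d) (τ : ℕ → Ω → ℝ≥0)
    (γ : ℝ≥0 → Ω → TemperedConfig d ε)
    (hγ : IsBirthDeathProcess P 𝓕 m b N e τ γ) :
    ∀ᵐ ω ∂P, ∀ (T : ℝ≥0) (Λ : Set (Pt d)), Bornology.IsBounded Λ →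
      ChangesFinitelyOften (fun t => (γ t ω).carrier ∩ Λ) T := by
  obtain ⟨C, hC⟩ := hb_bdd
  obtain ⟨D, hDc, hD⟩ := TopologicalSpace.exists_countable_dense ℝ≥0
  set B := TopologicalSpace.countableBasis (Pt d)
  have hB : TopologicalSpace.IsTopologicalBasis B := TopologicalSpace.isBasis_countableBasis _
  -- The exponential law is finite, being the law of a mark.
  have hexp : unitExp univ < ⊤ := by
    rw [← hγ.mark_law 0, Measure.map_apply (hγ.mark_measurable 0) MeasurableSet.univ]
    exact measure_lt_top P _
  have hfin : ∀ᵐ ω ∂P, ∀ k n : ℕ, (N ω ∩ (Icc 0 (k : ℝ≥0) ×ˢ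
      (Metric.ball (0 : Pt d) n ×ˢ (Icc 0 C ×ˢ univ)))).Finite := by
    refine ae_all_iff.2 fun k => ae_all_iff.2 fun n => hγ.poisson.ae_finite_inter ?_ ?_
    · exact measurableSet_Icc.prod
        (Metric.isOpen_ball.measurableSet.prod (measurableSet_Icc.prod MeasurableSet.univ))
    · exact (drivingMeasure_window_lt_top hexp k C Metric.isBounded_ball).ne
  have heq := (ae_ball_iff hDc).2 fun t (_ : t ∈ D) =>
    (ae_ball_iff (TopologicalSpace.countable_countableBasis (Pt d))).2
      fun U (hU : U ∈ B) => eventually_imp_distrib_left.2 fun hUb : Bornology.IsBounded U =>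
        hγ.equation t U (hB.isOpen hU).measurableSet hUb
  filter_upwards [hfin, heq] with ω hfin heq T Λ hΛ
  obtain ⟨k, hk⟩ := exists_nat_gt T
  obtain ⟨r, hr⟩ := hΛ.subset_ball (0 : Pt d)
  obtain ⟨n, hn⟩ := exists_nat_ge r
  set L : Set (Pt d) := Metric.ball 0 n
  have hL : Bornology.IsBounded L := Metric.isBounded_ball
  have hΛL : Λ ⊆ L := hr.trans (Metric.ball_subset_ball hn)
  have hR := finite_markedConfig hγ.enumeration (γ 0 ω) (fun i => τ i ω) hL
  refine ⟨eventTimes m.toNNReal (hfin k n).toFinset hR.toFinset, fun s t hst htT hF => ?_⟩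
  have hcount : ∀ s ∈ D, ∀ t ∈ D, s ≤ t → t ≤ (k : ℝ≥0) →
      (∀ c ∈ eventTimes m.toNNReal (hfin k n).toFinset hR.toFinset, c ∉ Ioc s t) →
      ∀ U ∈ B, U ⊆ L →
        ((γ s ω).carrier ∩ U).encard = ((γ t ω).carrier ∩ U).encard := by
    intro s hs t ht hst htk hF U hU hUL
    rw [heq s hs U hU (hL.subset hUL), heq t ht U hU (hL.subset hUL),
      livingAtoms_eq hm hst htk hUL (fun p => hC _ _) (hfin k n).coe_toFinset.ge hF,
      livingInitial_eq hm hst hUL hR.coe_toFinset.ge hF]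
  have hmain : (γ s ω).carrier ∩ L = (γ t ω).carrier ∩ L := by
    refine TemperedConfig.inter_eq_of_dense hε (hγ.cadlag ω) hD Metric.isOpen_ball hL
      (fun s hs t ht hst htk hF => ?_) hst (htT.trans_lt hk) hF
    have hc := hcount s hs t ht hst htk hF
    exact Subset.antisymm
      (inter_subset_of_encard_basis_eq hB (γ t ω).locallyFinite Metric.isOpen_ball hL hc)
      (inter_subset_of_encard_basis_eq hB (γ s ω).locallyFinite Metric.isOpen_ball hL
        fun U hU hUL => (hc U hU hUL).symm)
  show (γ s ω).carrier ∩ Λ = (γ t ω).carrier ∩ Λ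
  rw [← inter_eq_self_of_subset_right hΛL, ← inter_assoc, hmain, inter_assoc]
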